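/- Let $N\ge 1$ policies $\theta_1,\dots,\theta_N$, which are probability distributions on $K$ arms, be known to the player. At each round $t=1,\dots,T$ an algorithm selects (possibly at random, depending on the past) a policy index $I_t$; an arm $A_t$ is drawn from $\theta_{I_t}$; and the player observes the loss $\ell_t(A_t)$, where $(\ell_t)_{t=1}^T$, $\ell_t\in[0,1]^K$, is a fixed unknown sequence of losses. With $\ell_t(\theta)=\sum_{j=1}^K\theta(j)\ell_t(j)$, the regret is $$R_T=\mathbb E\sum_{t=1}^T\ell_t(\theta_{I_t})-\min_{i}\sum_{t=1}^T\ell_t(\theta_i).$$ Suppose that the policies are radially symmetric and uniform: each $\theta_i$ is uniform on a set $U_i$ of $M$ arms, the sets $U_i\cap U_{i'}$ with $i\ne i'$ all equal $C=\bigcap_i U_i$, and $|C|=V$; and suppose $V<M$ (hence $N\ge2$). Let $$T\ge\frac{NM}{4\log(4/3)\,(M-V)}.$$ Then for every algorithm there is a sequence of losses for which $$R_T\ge\frac1{18}\sqrt{N\,\frac{M-V}{M}\,T}.$$ This is optimal up to a factor $18\sqrt{2\log N}$: the quantity $\mathcal S^*=\sum_{j=1}^K\bigl(\max_i\theta_i(j)-\min_i\theta_i(j)\bigr)$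 equals $N\frac{M-V}{M}$, and the algorithm EXP4 with learning rate $\eta=\sqrt{2\log N/(T\mathcal S^*)}$ satisfies $R_T\le\sqrt{2T\mathcal S^*\log N}$ for every sequence of losses. (EXP4 draws $I_t$ with probabilities $P_t(i)\propto\exp\bigl(-\eta\sum_{s<t}\hat\ell_s(i)\bigr)$, where $\hat\ell_s(i)=\frac{\theta_i(A_s)}{\sum_kP_s(k)\theta_k(A_s)}\,\ell_s(A_s)$.) -/

import Mathlib

namespace FixedExperts

noncomputable section

/-- The probability distributions on `n` points. -/
abbrev Dist (n : ℕ) : Type := stdSimplex ℝ (Fin n)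

/-- A loss sequence: `ℓ t j ∈ [0, 1]` is the loss of action `j` at round `t` (rounds are numbered
from `0`). -/
abbrev LossSeq (K : ℕ) : Type := ℕ → Fin K → unitInterval

/-- What the player knows after `t` rounds: for every past round, the chosen policy, the drawn
action, and the observed loss of that action. -/
abbrev History (N K t : ℕ) : Type := Fin t → Fin N × Fin K × unitInterval

/-- A (randomized) algorithm: at each round, a distribution over the `N` policies, as an arbitrary
function of the history. -/
abbrev Algorithm (N K : ℕ) : Type := (t : ℕ) → History N K t → Dist N

section Interaction

variable {N K : ℕ}

/-- The history produced by the pairs (policy, action) of the first `t` rounds. -/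
def observed (ℓ : LossSeq K) {t : ℕ} (ω : Fin t → Fin N × Fin K) : History N K t :=
  fun s => ((ω s).1, (ω s).2, ℓ s (ω s).2)

/-- The probability that the first `t` rounds produce the pairs (policy, action) `ω`: in each round
the policy is drawn from the algorithm's distribution given the history, and the action is then
drawn from that policy. -/
def trajProb (θ : Fin N → Dist K) (alg : Algorithm N K) (ℓ : LossSeq K) :
    (t : ℕ) → (Fin t → Fin N × Fin K) → ℝ
  | 0, _ => 1
  | t + 1, ω =>
      trajProb θ alg ℓ t (fun s => ω s.castSucc)
        * (alg t (observed ℓ fun s => ω s.castSucc)).1 (ω (Fin.last t)).1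
        * (θ (ω (Fin.last t)).1).1 (ω (Fin.last t)).2

/-- The expected loss at round `t` of a policy `p`. -/
def policyLoss (p : Dist K) (ℓ : LossSeq K) (t : ℕ) : ℝ :=
  ∑ j, p.1 j * (ℓ t j : ℝ)

/-- The regret after `T` rounds: the expected sum of the losses `ℓ_t(θ_t)` of the selected policies,
minus the total loss of the best policy. -/
def regret (θ : Fin N → Dist K) (alg : Algorithm N K) (ℓ : LossSeq K) (T : ℕ) : ℝ :=
  (∑ ω : Fin T → Fin N × Fin K,
      trajProb θ alg ℓ T ω * ∑ t : Fin T, policyLoss (θ (ω t).1) ℓ t)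
    - ⨅ i, ∑ t : Fin T, policyLoss (θ i) ℓ t

/-- The support of a policy. -/
def supp (p : Dist K) : Finset (Fin K) := {j | p.1 j ≠ 0}

/-- The arms that lie in the support of every policy. -/
def commonArms (θ : Fin N → Dist K) : Finset (Fin K) := {j | ∀ i, j ∈ supp (θ i)}

/-- Radially symmetric uniform policies: every policy is uniform on `M` arms, the supports of any
two policies meet exactly in the arms common to all policies, and there are `V` common arms. -/
structure RadiallySymmetricUniform (θ : Fin N → Dist K) (M V : ℕ) : Prop where
  card_supp : ∀ i, (supp (θ i)).card = M
  uniform : ∀ i, ∀ j ∈ supp (θ i), (θ i).1 j = 1 / (M : ℝ)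
  inter_supp : ∀ i i', i ≠ i' → supp (θ i) ∩ supp (θ i') = commonArms θ
  card_common : (commonArms θ).card = V

/-- The similarity index `∑_j (max_θ θ(j) - min_θ θ(j))` of a policy set. -/
def simStar (θ : Fin N → Dist K) : ℝ :=
  ∑ j, ((⨆ i, (θ i).1 j) - ⨅ i, (θ i).1 j)

/-- Exponential weights: the distribution proportional to `exp (-η L i)`. -/
def expWeights (hN : 0 < N) (η : ℝ) (L : Fin N → ℝ) : Dist N :=
  ⟨fun i => Real.exp (-η * L i) / ∑ k, Real.exp (-η * L k), by
    have : Nonempty (Fin N) := ⟨⟨0, hN⟩⟩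
    refine ⟨fun i => by positivity, ?_⟩
    rw [← Finset.sum_div]
    exact div_self
      (Finset.sum_pos (fun i _ => Real.exp_pos _) Finset.univ_nonempty).ne'⟩

/-- The cumulative importance-weighted loss estimates of the algorithm EXP4 with learning
rate `η`. -/
def exp4Loss (hN : 0 < N) (θ : Fin N → Dist K) (η : ℝ) :
    (t : ℕ) → History N K t → Fin N → ℝ
  | 0, _, _ => 0
  | t + 1, h, i =>
      let L := exp4Loss hN θ η t (fun s => h s.castSucc)
      let a := (h (Fin.last t)).2.1
      let x := (h (Fin.last t)).2.2
      L i + (θ i).1 a / (∑ k, (expWeights hN η L).1 k * (θ k).1 a) * (x : ℝ)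

/-- EXP4 with the fixed expert advice `θ` and learning rate `η`. -/
def exp4 (hN : 0 < N) (θ : Fin N → Dist K) (η : ℝ) : Algorithm N K :=
  fun t h => expWeights hN η (exp4Loss hN θ η t h)

end Interaction

end

end FixedExperts

/-! Lower bound. Put α = (M - V)/M and give each policy a fresh coin in every round: its private
arms share the coin as loss, and common arms lose nothing. A policy then loses α times its coin, but
selecting it reveals that coin only with probability α, and never reveals another policy's coin.
Bias the coins of one hidden policy i by ε, and let N_i count its selections. Selecting any other
policy costs αε, so the expected regret is at least αε(T - E_i N_i) (`sum_coinTilt_mul_regret_ge`).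
Against fair coins, Hoeffding's lemma and the entropy inequality (`sum_tilted_le`) give E_i N_i ≤
E_0 N_i + T/8 + T·KL, where KL = α · `coinEntropy ε` · E_0 N_i (`sum_neg_log_obsRatio`). This is
linear in E_0 N_i, and the E_0 N_i sum to T; so with ε² of order N/(αT) the average over i of E_i
N_i is at most 3T/4, and some fixed loss sequence forces regret αεT/4.

Upper bound. The log of the total weight is the usual potential for EXP4. Subtracting a common
constant from all loss estimates does not change the weights, so the second-order term may be
computed after subtracting the smallest estimate for the drawn arm. Its expectation per round is
then at most the similarity index (`mixProb_mul_logWeight_le`), which equals Nα because only private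
arms contribute. -/

namespace FixedExperts

/-! ### Expectations over trajectories of the interaction. -/

section Trajectories

variable {N K : ℕ}

lemma Dist.nonneg {n : ℕ} (p : Dist n) (i : Fin n) : 0 ≤ p.1 i := p.2.1 i

lemma Dist.sum_eq_one {n : ℕ} (p : Dist n) : ∑ i, p.1 i = 1 := p.2.2

lemma sum_fin_succ_fun {X : Type*} [Fintype X] (t : ℕ) (F : (Fin (t + 1) → X) → ℝ) :
    ∑ ω, F ω = ∑ ω : Fin t → X, ∑ x, F (Fin.snoc ω x) := by
  rw [← (Fin.snocEquiv (fun _ : Fin (t + 1) => X)).sum_comp, Fintype.sum_prod_type_right]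
  rfl

lemma trajProb_snoc (θ : Fin N → Dist K) (alg : Algorithm N K) (ℓ : LossSeq K) (t : ℕ)
    (ω : Fin t → Fin N × Fin K) (x : Fin N × Fin K) :
    trajProb θ alg ℓ (t + 1) (Fin.snoc ω x) =
      trajProb θ alg ℓ t ω * (alg t (observed ℓ ω)).1 x.1 * (θ x.1).1 x.2 := by
  simp [trajProb]

/-- Conditioning on the first `t` rounds. -/
lemma sum_trajProb_succ (θ : Fin N → Dist K) (alg : Algorithm N K) (ℓ : LossSeq K) (t : ℕ)
    (F : (Fin (t + 1) → Fin N × Fin K) → ℝ) :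
    ∑ ω, trajProb θ alg ℓ (t + 1) ω * F ω =
      ∑ ω, trajProb θ alg ℓ t ω * ∑ i, (alg t (observed ℓ ω)).1 i *
        ∑ a, (θ i).1 a * F (Fin.snoc ω (i, a)) := by
  rw [sum_fin_succ_fun]
  refine Finset.sum_congr rfl fun ω _ => ?_
  rw [Fintype.sum_prod_type, Finset.mul_sum]
  refine Finset.sum_congr rfl fun i _ => ?_
  rw [Finset.mul_sum, Finset.mul_sum]
  refine Finset.sum_congr rfl fun a _ => ?_
  rw [trajProb_snoc]; ring

lemma trajProb_nonneg (θ : Fin N → Dist K) (alg : Algorithm N K) (ℓ : LossSeq K) (t : ℕ)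
    (ω : Fin t → Fin N × Fin K) : 0 ≤ trajProb θ alg ℓ t ω := by
  induction t with
  | zero => simp [trajProb]
  | succ t ih =>
    exact mul_nonneg (mul_nonneg (ih _) (Dist.nonneg _ _)) (Dist.nonneg _ _)

/-- A function of the first `t` rounds has the same expectation over `t + 1` rounds. -/
lemma sum_trajProb_succ_init (θ : Fin N → Dist K) (alg : Algorithm N K) (ℓ : LossSeq K) (t : ℕ)
    (F : (Fin t → Fin N × Fin K) → ℝ) :
    ∑ ω, trajProb θ alg ℓ (t + 1) ω * F (fun s => ω s.castSucc) =
      ∑ ω, trajProb θ alg ℓ t ω * F ω := by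
  rw [sum_trajProb_succ]
  simp [← Finset.sum_mul, Dist.sum_eq_one]

lemma sum_trajProb (θ : Fin N → Dist K) (alg : Algorithm N K) (ℓ : LossSeq K) (t : ℕ) :
    ∑ ω, trajProb θ alg ℓ t ω = 1 := by
  induction t with
  | zero => simp [trajProb]
  | succ t ih => simpa [ih] using sum_trajProb_succ_init θ alg ℓ t (fun _ => 1)

/-- The expectation of an additive functional of the trajectory. -/
lemma sum_trajProb_additive (θ : Fin N → Dist K) (alg : Algorithm N K) (ℓ : LossSeq K) (T : ℕ)
    (f : ℕ → Fin N → Fin K → ℝ) :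
    ∑ ω, trajProb θ alg ℓ T ω * ∑ t : Fin T, f t (ω t).1 (ω t).2 =
      ∑ t : Fin T, ∑ ω, trajProb θ alg ℓ t ω * ∑ i, (alg t (observed ℓ ω)).1 i *
        ∑ a, (θ i).1 a * f t i a := by
  induction T with
  | zero => simp
  | succ T ih =>
    simp only [Fin.sum_univ_castSucc, mul_add, Finset.sum_add_distrib, Fin.val_castSucc,
      Fin.val_last]
    rw [← ih]
    congr 1
    · exact sum_trajProb_succ_init θ alg ℓ T fun ω => ∑ t : Fin T, f t (ω t).1 (ω t).2
    · rw [sum_trajProb_succ]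
      simp

/-- The trajectory probabilities depend on the losses only through the observed ones. -/
lemma trajProb_congr (θ : Fin N → Dist K) (alg : Algorithm N K) (ℓ ℓ' : LossSeq K) (t : ℕ)
    (ω : Fin t → Fin N × Fin K) (h : ∀ s : Fin t, ℓ s (ω s).2 = ℓ' s (ω s).2) :
    trajProb θ alg ℓ t ω = trajProb θ alg ℓ' t ω := by
  induction t with
  | zero => rfl
  | succ t ih =>
    have hobs : observed ℓ (fun s : Fin t => ω s.castSucc) =
        (observed ℓ' (fun s : Fin t => ω s.castSucc) : History N K t) := by
      funext s
      simpa [observed] using h s.castSucc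
    simp only [trajProb]
    rw [ih _ fun s => by simpa using h s.castSucc, hobs]

lemma observed_congr (ℓ ℓ' : LossSeq K) (t : ℕ)
    (ω : Fin t → Fin N × Fin K) (h : ∀ s : Fin t, ℓ s (ω s).2 = ℓ' s (ω s).2) :
    observed ℓ ω = observed ℓ' ω := by
  funext s
  simp [observed, h s]

lemma regret_eq (θ : Fin N → Dist K) (alg : Algorithm N K) (ℓ : LossSeq K) (T : ℕ) :
    regret θ alg ℓ T =
      (∑ t : Fin T, ∑ ω, trajProb θ alg ℓ t ω * ∑ i, (alg t (observed ℓ ω)).1 i *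
        policyLoss (θ i) ℓ t) - ⨅ i, ∑ t : Fin T, policyLoss (θ i) ℓ t := by
  unfold regret
  rw [sum_trajProb_additive θ alg ℓ T fun t i _ => policyLoss (θ i) ℓ t]
  simp [← Finset.sum_mul, Dist.sum_eq_one]

end Trajectories

/-! ### Hoeffding's lemma and the entropy inequality on a finite set. -/

section FiniteEntropy

open MeasureTheory ProbabilityTheory in
/-- Hoeffding's lemma for a probability vector. -/
lemma sum_mul_exp_le_of_mem_Icc {X : Type*} [Fintype X] (q f : X → ℝ) (hq : ∀ x, 0 ≤ q x)
    (hq1 : ∑ x, q x = 1) (hf : ∀ x, f x ∈ Set.Icc (0 : ℝ) 1) :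
    ∑ x, q x * Real.exp (-(f x - ∑ y, q y * f y)) ≤ Real.exp (1 / 8) := by
  let _ : MeasurableSpace X := ⊤
  let μ : Measure X := ∑ x, ENNReal.ofReal (q x) • Measure.dirac x
  have hint : ∀ g : X → ℝ, ∫ x, g x ∂μ = ∑ x, q x * g x := by
    intro g
    rw [integral_finsetSum_measure]
    · refine Finset.sum_congr rfl fun x _ => ?_
      rw [integral_smul_measure, integral_dirac, ENNReal.toReal_ofReal (hq x), smul_eq_mul]
    · intro x _
      exact (integrable_dirac (by simp)).smul_measure ENNReal.ofReal_ne_top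
  have : IsProbabilityMeasure μ := by
    constructor
    simp only [μ, Measure.finsetSum_apply, Measure.smul_apply, measure_univ, smul_eq_mul, mul_one]
    rw [← ENNReal.ofReal_sum_of_nonneg fun x _ => hq x, hq1, ENNReal.ofReal_one]
  -- The variance proxy is ((1 - 0)/2)² = 1/4; at -1 the exponent is 1/8.
  have h := (hasSubgaussianMGF_of_mem_Icc (μ := μ) (X := f) (a := 0) (b := 1)
    (measurable_of_finite f).aemeasurable (Filter.Eventually.of_forall hf)).mgf_le (-1)
  rw [mgf, hint, hint] at h
  convert h using 2
  · simp
  · norm_num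

/-- Change of measure: the expectation of `f ∈ [0, 1]` under the law with density `L` exceeds the
one under `p` by at most `1 / 8` plus the relative entropy. -/
lemma sum_tilted_le {X : Type*} [Fintype X] (p L f : X → ℝ) (hp : ∀ x, 0 ≤ p x)
    (hp1 : ∑ x, p x = 1) (hL : ∀ x, 0 < L x) (hL1 : ∑ x, p x * L x = 1)
    (hf : ∀ x, f x ∈ Set.Icc (0 : ℝ) 1) :
    ∑ x, p x * L x * f x ≤ ∑ x, p x * f x + 1 / 8 + ∑ x, p x * -Real.log (L x) := by
  have hoef := sum_mul_exp_le_of_mem_Icc (fun x => p x * L x) f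
    (fun x => mul_nonneg (hp x) (hL x).le) hL1 hf
  set m := ∑ x, p x * L x * f x with hm
  -- Gibbs' variational inequality, pointwise: 1 + u ≤ exp u at u = log L - (f - m) - 1/8, weighted
  -- by p. Summing it leaves only the Hoeffding bound to insert.
  have hpt : ∀ x, p x * (Real.log (L x) - (f x - m) - 1 / 8 + 1) ≤
      p x * L x * Real.exp (-(f x - m)) * Real.exp (-(1 / 8)) := by
    intro x
    have h1 := Real.add_one_le_exp (Real.log (L x) - (f x - m) - 1 / 8)
    have h2 : Real.exp (Real.log (L x) - (f x - m) - 1 / 8) =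
        L x * Real.exp (-(f x - m)) * Real.exp (-(1 / 8)) := by
      rw [sub_eq_add_neg, sub_eq_add_neg, Real.exp_add, Real.exp_add, Real.exp_log (hL x)]
    rw [h2] at h1
    calc _ ≤ _ := mul_le_mul_of_nonneg_left h1 (hp x)
      _ = _ := by ring
  have h3 := Finset.sum_le_sum fun x (_ : x ∈ Finset.univ) => hpt x
  rw [← Finset.sum_mul] at h3
  have h4 : (∑ x, p x * L x * Real.exp (-(f x - m))) * Real.exp (-(1 / 8)) ≤ 1 := by
    calc _ ≤ Real.exp (1 / 8) * Real.exp (-(1 / 8)) :=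
          mul_le_mul_of_nonneg_right hoef (Real.exp_pos _).le
      _ = 1 := by rw [← Real.exp_add]; simp
  have h5 : ∑ x, p x * (Real.log (L x) - (f x - m) - 1 / 8 + 1) =
      -(∑ x, p x * -Real.log (L x)) - ∑ x, p x * f x + (m - 1 / 8 + 1) * ∑ x, p x := by
    rw [Finset.mul_sum, ← Finset.sum_neg_distrib, ← Finset.sum_sub_distrib,
      ← Finset.sum_add_distrib]
    exact Finset.sum_congr rfl fun x _ => by ring
  rw [h5, hp1] at h3
  linarith

end FiniteEntropy

/-! ### Averages over independent fair coins, as unnormalised sums over all outcomes. -/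

section CoinFlips

variable {ι : Type*} [DecidableEq ι] [Fintype ι]

/-- Averaging over one coin on which the other factor does not depend. -/
lemma sum_mul_coin (c : ι) (g : (ι → Bool) → ℝ) (φ : Bool → ℝ)
    (hg : ∀ b, g (Function.update b c (!b c)) = g b) :
    ∑ b, g b * φ (b c) = (φ true + φ false) / 2 * ∑ b, g b := by
  -- Flipping the coin `c` is an involution that fixes `g` and exchanges the two values of `φ`.
  let e : (ι → Bool) ≃ (ι → Bool) :=
    Function.Involutive.toPerm (fun b => Function.update b c (!b c)) (by intro b; simp)
  have h1 : ∑ b, g b * φ (b c) = ∑ b, g b * φ (!b c) := by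
    rw [← e.sum_comp]
    refine Finset.sum_congr rfl fun b _ => ?_
    simp [e, Function.Involutive.toPerm, hg]
  have h2 : ∑ b, g b * φ (b c) + ∑ b, g b * φ (!b c) = (φ true + φ false) * ∑ b, g b := by
    rw [← Finset.sum_add_distrib, Finset.mul_sum]
    refine Finset.sum_congr rfl fun b _ => ?_
    cases b c <;> simp <;> ring
  linarith

/-- The density, with respect to a fair coin, of a coin that shows `true` with
probability `1 / 2 - ε`. -/
noncomputable def coinDensity (ε : ℝ) (x : Bool) : ℝ := if x then 1 - 2 * ε else 1 + 2 * ε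

/-- Biased coins on which the other factor does not depend can be replaced by fair ones. -/
lemma sum_prod_coinDensity {κ : Type*} [DecidableEq κ] (ε : ℝ) (c : κ → ι)
    (hc : Function.Injective c) (S : Finset κ) (g : (ι → Bool) → ℝ)
    (hg : ∀ t ∈ S, ∀ b, g (Function.update b (c t) (!b (c t))) = g b) :
    ∑ b, g b * ∏ t ∈ S, coinDensity ε (b (c t)) = ∑ b, g b := by
  induction S using Finset.induction_on with
  | empty => simp
  | insert t S ht ih =>
    -- Injectivity of `c` keeps the coin of `t` out of the remaining product, and the density has
    -- mean 1 under a fair coin.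
    have h := sum_mul_coin (c t) (fun b => g b * ∏ s ∈ S, coinDensity ε (b (c s)))
      (coinDensity ε) (by
        intro b
        rw [hg t (Finset.mem_insert_self t S)]
        congr 1
        refine Finset.prod_congr rfl fun s hs => ?_
        rw [Function.update_of_ne]
        exact fun h => ht (hc h ▸ hs))
    simp_rw [Finset.prod_insert ht]
    calc _ = ∑ b, (g b * ∏ s ∈ S, coinDensity ε (b (c s))) * coinDensity ε (b (c t)) :=
          Finset.sum_congr rfl fun b _ => by ring
      _ = ∑ b, g b * ∏ s ∈ S, coinDensity ε (b (c s)) := by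
          rw [h]; simp [coinDensity]
      _ = ∑ b, g b := ih fun s hs => hg s (Finset.mem_insert_of_mem hs)

end CoinFlips

end FixedExperts

namespace FixedExperts

/-! ### The regret of EXP4 in terms of the similarity index. -/

section ExponentialWeights

variable {N K : ℕ}

/-- Multiply by exp y ≥ 1 + y + y²/2: the product (1 - y + y²/2)(1 + y + y²/2) is 1 + y⁴/4. -/
lemma exp_neg_le_quadratic {y : ℝ} (hy : 0 ≤ y) : Real.exp (-y) ≤ 1 - y + y ^ 2 / 2 := by
  have h := Real.quadratic_le_exp_of_nonneg hy
  rw [Real.exp_neg, inv_le_iff_one_le_mul₀ (Real.exp_pos y)]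
  have h2 : 0 ≤ 1 - y + y ^ 2 / 2 := by nlinarith [sq_nonneg (y - 1)]
  nlinarith [mul_le_mul_of_nonneg_left h h2, sq_nonneg (y ^ 2)]

/-- The logarithm of the total weight. -/
noncomputable def logWeight (η : ℝ) (L : Fin N → ℝ) : ℝ := Real.log (∑ k, Real.exp (-η * L k))

lemma totalWeight_pos (hN : 0 < N) (η : ℝ) (L : Fin N → ℝ) : 0 < ∑ k, Real.exp (-η * L k) :=
  have : Nonempty (Fin N) := ⟨⟨0, hN⟩⟩
  Finset.sum_pos (fun _ _ => Real.exp_pos _) Finset.univ_nonempty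

lemma expWeights_apply (hN : 0 < N) (η : ℝ) (L : Fin N → ℝ) (i : Fin N) :
    (expWeights hN η L).1 i = Real.exp (-η * L i) / ∑ k, Real.exp (-η * L k) := rfl

lemma expWeights_pos (hN : 0 < N) (η : ℝ) (L : Fin N → ℝ) (i : Fin N) :
    0 < (expWeights hN η L).1 i := by
  rw [expWeights_apply]
  exact div_pos (Real.exp_pos _) (totalWeight_pos hN η L)

lemma neg_mul_le_logWeight (hN : 0 < N) (η : ℝ) (L : Fin N → ℝ) (i : Fin N) :
    -η * L i ≤ logWeight η L := by
  rw [logWeight, Real.le_log_iff_exp_le (totalWeight_pos hN η L)]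
  exact Finset.single_le_sum (f := fun k => Real.exp (-η * L k))
    (fun k _ => (Real.exp_pos _).le) (Finset.mem_univ i)

/-- The one-step potential bound, with the second moment taken after a shift by a lower bound `m`
of the increments. -/
lemma logWeight_add_le (hN : 0 < N) {η : ℝ} (hη : 0 ≤ η) (L x : Fin N → ℝ) (m : ℝ)
    (hm : ∀ k, m ≤ x k) :
    logWeight η (fun k => L k + x k) ≤ logWeight η L
      - η * ∑ k, (expWeights hN η L).1 k * x k
      + η ^ 2 / 2 * ∑ k, (expWeights hN η L).1 k * (x k - m) ^ 2 := by
  have hW := totalWeight_pos hN η L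
  have hW' := totalWeight_pos hN η (fun k => L k + x k)
  set P := expWeights hN η L with hP
  -- Factoring out exp(-ηm) makes the remaining exponents nonpositive, as the quadratic bound needs;
  -- the term ηm it leaves cancels after the expansion.
  have h1 : ∑ k, Real.exp (-η * (L k + x k)) =
      (∑ k, Real.exp (-η * L k)) *
        (Real.exp (-η * m) * ∑ k, P.1 k * Real.exp (-(η * (x k - m)))) := by
    rw [Finset.mul_sum, Finset.mul_sum]
    refine Finset.sum_congr rfl fun k _ => ?_
    rw [hP, expWeights_apply]
    have : Real.exp (-η * (L k + x k)) =
        Real.exp (-η * L k) * (Real.exp (-η * m) * Real.exp (-(η * (x k - m)))) := by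
      rw [← Real.exp_add, ← Real.exp_add]; congr 1; ring
    calc _ = Real.exp (-η * L k) * (Real.exp (-η * m) * Real.exp (-(η * (x k - m)))) := this
      _ = (∑ k, Real.exp (-η * L k)) * (Real.exp (-η * L k) / ∑ k, Real.exp (-η * L k)) *
          (Real.exp (-η * m) * Real.exp (-(η * (x k - m)))) := by
        rw [mul_div_cancel₀ _ hW.ne']
      _ = _ := by ring
  have hpos : 0 < ∑ k, P.1 k * Real.exp (-(η * (x k - m))) := by
    rw [h1] at hW'
    exact pos_of_mul_pos_right (pos_of_mul_pos_right hW' hW.le) (Real.exp_pos _).le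
  rw [logWeight, h1, Real.log_mul hW.ne' (mul_pos (Real.exp_pos _) hpos).ne',
    Real.log_mul (Real.exp_pos _).ne' hpos.ne', Real.log_exp]
  have h2 := Real.log_le_sub_one_of_pos hpos
  have h3 : ∑ k, P.1 k * Real.exp (-(η * (x k - m))) ≤
      ∑ k, P.1 k * (1 - η * (x k - m) + (η * (x k - m)) ^ 2 / 2) :=
    Finset.sum_le_sum fun k _ => mul_le_mul_of_nonneg_left
      (exp_neg_le_quadratic (mul_nonneg hη (sub_nonneg.2 (hm k)))) (P.nonneg k)
  have h4 : ∑ k, P.1 k * (1 - η * (x k - m) + (η * (x k - m)) ^ 2 / 2) =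
      (1 + η * m) * ∑ k, P.1 k - η * ∑ k, P.1 k * x k
        + η ^ 2 / 2 * ∑ k, P.1 k * (x k - m) ^ 2 := by
    rw [Finset.mul_sum, Finset.mul_sum, Finset.mul_sum, ← Finset.sum_sub_distrib,
      ← Finset.sum_add_distrib]
    exact Finset.sum_congr rfl fun k _ => by ring
  rw [h4, P.sum_eq_one] at h3
  change logWeight η L + _ ≤ _
  linarith

/-- The probability of the action `a` when the policy is drawn from `P`. -/
noncomputable def mixProb (θ : Fin N → Dist K) (P : Dist N) (a : Fin K) : ℝ :=
  ∑ k, P.1 k * (θ k).1 a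

lemma mixProb_nonneg (θ : Fin N → Dist K) (P : Dist N) (a : Fin K) : 0 ≤ mixProb θ P a :=
  Finset.sum_nonneg fun k _ => mul_nonneg (P.nonneg k) ((θ k).nonneg a)

lemma sum_mul_sum_eq_mixProb (θ : Fin N → Dist K) (P : Dist N) (F : Fin K → ℝ) :
    ∑ i, P.1 i * ∑ a, (θ i).1 a * F a = ∑ a, mixProb θ P a * F a := by
  simp_rw [mixProb, Finset.mul_sum, Finset.sum_mul]
  rw [Finset.sum_comm]
  exact Finset.sum_congr rfl fun _ _ => Finset.sum_congr rfl fun _ _ => by ring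

/-- One arm's contribution to the expected potential change, with the shift taken to be the smallest
estimate over the policies. Summing over arms turns the last term into `simStar`. -/
lemma mixProb_mul_logWeight_le (hN : 0 < N) (θ : Fin N → Dist K) {η : ℝ} (hη : 0 ≤ η)
    (L : Fin N → ℝ) (a : Fin K) (x : unitInterval) :
    mixProb θ (expWeights hN η L) a * logWeight η (fun k =>
        L k + (θ k).1 a / mixProb θ (expWeights hN η L) a * (x : ℝ)) ≤
      mixProb θ (expWeights hN η L) a * logWeight η L
        - η * (mixProb θ (expWeights hN η L) a * x)
        + η ^ 2 / 2 * ((⨆ i, (θ i).1 a) - ⨅ i, (θ i).1 a) := by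
  have : Nonempty (Fin N) := ⟨⟨0, hN⟩⟩
  set P := expWeights hN η L with hP
  set q := mixProb θ P a with hq
  set u := ⨆ i, (θ i).1 a
  set m := ⨅ i, (θ i).1 a
  have hu : ∀ i, (θ i).1 a ≤ u := le_ciSup (Set.finite_range _).bddAbove
  have hm : ∀ i, m ≤ (θ i).1 a := ciInf_le (Set.finite_range _).bddBelow
  have hm0 : 0 ≤ m := le_ciInf fun i => (θ i).nonneg a
  have hmu : m ≤ u := (hm ⟨0, hN⟩).trans (hu ⟨0, hN⟩)
  have hx0 : (0 : ℝ) ≤ x := x.2.1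
  have hx1 : (x : ℝ) ≤ 1 := x.2.2
  rcases (mixProb_nonneg θ P a).eq_or_lt with h0 | h0
  · rw [← hq] at h0
    rw [← h0]
    have : 0 ≤ η ^ 2 / 2 * (u - m) := mul_nonneg (by positivity) (sub_nonneg.2 hmu)
    simpa using this
  · rw [← hq] at h0
    have h1 := logWeight_add_le hN hη L (fun k => (θ k).1 a / q * (x : ℝ)) (m / q * x)
      (fun k => by gcongr; exact hm k)
    rw [← hP] at h1
    have h2 : ∑ k, P.1 k * ((θ k).1 a / q * (x : ℝ)) = x := by
      calc _ = (∑ k, P.1 k * (θ k).1 a) / q * x := by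
            rw [Finset.sum_div, Finset.sum_mul]
            exact Finset.sum_congr rfl fun k _ => by ring
        _ = x := by
            change q / q * x = x
            rw [div_self h0.ne', one_mul]
    -- With 0 ≤ m ≤ θ_k(a) ≤ u one has (θ_k(a) - m)² ≤ (u - m) θ_k(a), and the `P`-mean of θ_k(a) is
    -- `q`, which cancels the importance weight.
    have h3 : q * ∑ k, P.1 k * ((θ k).1 a / q * x - m / q * x) ^ 2 ≤ u - m := by
      calc _ = ∑ k, P.1 k * (((θ k).1 a - m) * ((θ k).1 a - m)) / q * (x : ℝ) ^ 2 := by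
            rw [Finset.mul_sum]
            exact Finset.sum_congr rfl fun k _ => by field_simp
        _ ≤ ∑ k, P.1 k * ((u - m) * (θ k).1 a) / q * 1 := by
            refine Finset.sum_le_sum fun k _ => ?_
            have := P.nonneg k
            have := hm k
            gcongr
            · exact div_nonneg (mul_nonneg ‹_› (mul_nonneg (by linarith) ((θ k).nonneg a))) h0.le
            · exact hu k
            · linarith
            · exact pow_le_one₀ hx0 hx1
        _ = (u - m) * ((∑ k, P.1 k * (θ k).1 a) / q) := by
            rw [Finset.sum_div, Finset.mul_sum]
            exact Finset.sum_congr rfl fun k _ => by ring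
        _ = u - m := by
            change (u - m) * (q / q) = u - m
            rw [div_self h0.ne', mul_one]
    rw [h2] at h1
    have h4 := mul_le_mul_of_nonneg_left h1 h0.le
    have h5 := mul_le_mul_of_nonneg_left h3 (by positivity : (0 : ℝ) ≤ η ^ 2 / 2)
    linarith

lemma exp4Loss_snoc (hN : 0 < N) (θ : Fin N → Dist K) (η : ℝ) (ℓ : LossSeq K) (t : ℕ)
    (ω : Fin t → Fin N × Fin K) (i : Fin N) (a : Fin K) :
    exp4Loss hN θ η (t + 1) (observed ℓ (Fin.snoc ω (i, a) : Fin (t + 1) → Fin N × Fin K)) =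
      fun k => exp4Loss hN θ η t (observed ℓ ω) k
        + (θ k).1 a / mixProb θ (expWeights hN η (exp4Loss hN θ η t (observed ℓ ω))) a
          * (ℓ t a : ℝ) := by
  funext k
  simp [exp4Loss, observed, mixProb]
  rfl

/-- The expected logarithmic potential of EXP4. -/
lemma expected_logWeight_le (hN : 0 < N) (θ : Fin N → Dist K) {η : ℝ} (hη : 0 ≤ η)
    (ℓ : LossSeq K) (T : ℕ) :
    ∑ ω, trajProb θ (exp4 hN θ η) ℓ T ω * logWeight η (exp4Loss hN θ η T (observed ℓ ω)) ≤
      Real.log N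
        - η * ∑ t : Fin T, ∑ ω, trajProb θ (exp4 hN θ η) ℓ t ω *
            ∑ i, (exp4 hN θ η t (observed ℓ ω)).1 i * policyLoss (θ i) ℓ t
        + T * (η ^ 2 / 2 * simStar θ) := by
  induction T with
  | zero => simp [trajProb, logWeight, exp4Loss]
  | succ T ih =>
    rw [sum_trajProb_succ, Fin.sum_univ_castSucc]
    simp only [Fin.val_castSucc, Fin.val_last]
    have key : ∀ ω : Fin T → Fin N × Fin K,
        trajProb θ (exp4 hN θ η) ℓ T ω * ∑ i, (exp4 hN θ η T (observed ℓ ω)).1 i *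
          ∑ a, (θ i).1 a * logWeight η (exp4Loss hN θ η (T + 1)
            (observed ℓ (Fin.snoc ω (i, a) : Fin (T + 1) → Fin N × Fin K))) ≤
        trajProb θ (exp4 hN θ η) ℓ T ω * logWeight η (exp4Loss hN θ η T (observed ℓ ω))
          - η * (trajProb θ (exp4 hN θ η) ℓ T ω *
            ∑ i, (exp4 hN θ η T (observed ℓ ω)).1 i * policyLoss (θ i) ℓ T)
          + trajProb θ (exp4 hN θ η) ℓ T ω * (η ^ 2 / 2 * simStar θ) := by
      intro ω
      simp_rw [exp4Loss_snoc, policyLoss]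
      rw [sum_mul_sum_eq_mixProb, sum_mul_sum_eq_mixProb]
      simp only [exp4]
      set L := exp4Loss hN θ η T (observed ℓ ω)
      have h := Finset.sum_le_sum fun a (_ : a ∈ Finset.univ) =>
        mixProb_mul_logWeight_le hN θ hη L a (ℓ T a)
      rw [Finset.sum_add_distrib, Finset.sum_sub_distrib, ← Finset.sum_mul, ← Finset.mul_sum,
        ← Finset.mul_sum] at h
      have h1 : ∑ a, mixProb θ (expWeights hN η L) a = 1 := by
        have := sum_mul_sum_eq_mixProb θ (expWeights hN η L) (fun _ => 1)
        simpa [Dist.sum_eq_one] using this.symm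
      rw [h1, one_mul] at h
      have := mul_le_mul_of_nonneg_left h (trajProb_nonneg θ (exp4 hN θ η) ℓ T ω)
      refine this.trans (le_of_eq ?_)
      rw [simStar]
      ring
    have h := Finset.sum_le_sum fun ω (_ : ω ∈ Finset.univ) => key ω
    rw [Finset.sum_add_distrib, Finset.sum_sub_distrib, ← Finset.sum_mul, ← Finset.mul_sum,
      sum_trajProb] at h
    push_cast
    linarith

/-- The loss estimates of EXP4 are unbiased. -/
lemma expected_exp4Loss (hN : 0 < N) (θ : Fin N → Dist K) (η : ℝ) (ℓ : LossSeq K) (T : ℕ)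
    (k : Fin N) :
    ∑ ω, trajProb θ (exp4 hN θ η) ℓ T ω * exp4Loss hN θ η T (observed ℓ ω) k =
      ∑ t : Fin T, policyLoss (θ k) ℓ t := by
  induction T with
  | zero => simp [exp4Loss]
  | succ T ih =>
    rw [sum_trajProb_succ, Fin.sum_univ_castSucc]
    simp only [Fin.val_castSucc, Fin.val_last]
    rw [← ih, ← one_mul (policyLoss (θ k) ℓ T), ← sum_trajProb θ (exp4 hN θ η) ℓ T,
      Finset.sum_mul, ← Finset.sum_add_distrib]
    refine Finset.sum_congr rfl fun ω _ => ?_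
    simp_rw [exp4Loss_snoc]
    rw [sum_mul_sum_eq_mixProb, ← mul_add]
    congr 1
    simp only [exp4]
    set L := exp4Loss hN θ η T (observed ℓ ω)
    have h1 : ∑ a, mixProb θ (expWeights hN η L) a = 1 := by
      have := sum_mul_sum_eq_mixProb θ (expWeights hN η L) (fun _ => 1)
      simpa [Dist.sum_eq_one] using this.symm
    simp_rw [mul_add]
    rw [Finset.sum_add_distrib, ← Finset.sum_mul, h1, one_mul, policyLoss]
    congr 1
    refine Finset.sum_congr rfl fun a _ => ?_
    -- Exponential weights are positive, so an arm of mixture probability zero has probability zero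
    -- under every policy; division by zero loses nothing.
    rcases eq_or_ne (mixProb θ (expWeights hN η L) a) 0 with h0 | h0
    · have h2 := (Finset.sum_eq_zero_iff_of_nonneg fun k _ =>
        mul_nonneg ((expWeights hN η L).nonneg k) ((θ k).nonneg a)).1 h0 k (Finset.mem_univ k)
      have h3 : (θ k).1 a = 0 := (mul_eq_zero.1 h2).resolve_left (expWeights_pos hN η L k).ne'
      simp [h3]
    · field_simp

/-- The regret bound of EXP4 with fixed expert advice, in terms of the similarity index. -/
theorem exp4_regret_le (hN : 0 < N) (θ : Fin N → Dist K) {η : ℝ} (hη : 0 ≤ η)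
    (ℓ : LossSeq K) (T : ℕ) :
    η * regret θ (exp4 hN θ η) ℓ T ≤ Real.log N + T * (η ^ 2 / 2 * simStar θ) := by
  have : Nonempty (Fin N) := ⟨⟨0, hN⟩⟩
  obtain ⟨k, hk⟩ := exists_eq_ciInf_of_finite (f := fun i => ∑ t : Fin T, policyLoss (θ i) ℓ t)
  rw [regret_eq, ← hk, ← expected_exp4Loss hN θ η ℓ T k]
  have h1 := expected_logWeight_le hN θ hη ℓ T
  have h2 : ∑ ω, trajProb θ (exp4 hN θ η) ℓ T ω * (-η * exp4Loss hN θ η T (observed ℓ ω) k) ≤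
      ∑ ω, trajProb θ (exp4 hN θ η) ℓ T ω * logWeight η (exp4Loss hN θ η T (observed ℓ ω)) :=
    Finset.sum_le_sum fun ω _ => mul_le_mul_of_nonneg_left (neg_mul_le_logWeight hN η _ k)
      (trajProb_nonneg θ (exp4 hN θ η) ℓ T ω)
  have h3 : ∑ ω, trajProb θ (exp4 hN θ η) ℓ T ω * (-η * exp4Loss hN θ η T (observed ℓ ω) k) =
      -η * ∑ ω, trajProb θ (exp4 hN θ η) ℓ T ω * exp4Loss hN θ η T (observed ℓ ω) k := by
    rw [Finset.mul_sum]
    exact Finset.sum_congr rfl fun ω _ => by ring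
  rw [h3] at h2
  linarith

/-- EXP4 with the optimal learning rate. -/
theorem exp4_regret_le_sqrt (hN : 1 < N) (θ : Fin N → Dist K) (hθ : 0 < simStar θ)
    (ℓ : LossSeq K) {T : ℕ} (hT : 0 < T) :
    regret θ (exp4 (zero_lt_one.trans hN) θ (Real.sqrt (2 * Real.log N / (T * simStar θ)))) ℓ T ≤
      Real.sqrt (2 * T * simStar θ * Real.log N) := by
  have hlog : 0 < Real.log N := Real.log_pos (by exact_mod_cast hN)
  have hT' : (0 : ℝ) < T := by exact_mod_cast hT
  have hη : 0 < Real.sqrt (2 * Real.log N / (T * simStar θ)) := Real.sqrt_pos.2 (by positivity)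
  have h := exp4_regret_le (zero_lt_one.trans hN) θ hη.le ℓ T
  -- For this η both terms of `exp4_regret_le` equal log N, and η times the claimed bound is 2 log
  -- N.
  refine le_of_mul_le_mul_left (h.trans (le_of_eq ?_)) hη
  rw [← Real.sqrt_mul (by positivity), Real.sq_sqrt (by positivity)]
  have : 2 * Real.log N / (T * simStar θ) * (2 * T * simStar θ * Real.log N) =
      (2 * Real.log N) ^ 2 := by field_simp
  rw [this, Real.sqrt_sq (by positivity)]
  field_simp
  ring

end ExponentialWeights

end FixedExperts

namespace FixedExperts

/-! ### Private arms and the value of the similarity index. -/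

section PrivateArms

variable {N K : ℕ}

/-- The arms of the policy `i` that are not common to all policies. -/
noncomputable def privateArms (θ : Fin N → Dist K) (i : Fin N) : Finset (Fin K) := supp (θ i) \ commonArms θ

lemma mem_supp {p : Dist K} {a : Fin K} : a ∈ supp p ↔ p.1 a ≠ 0 := by simp [supp]

lemma mem_commonArms {θ : Fin N → Dist K} {a : Fin K} :
    a ∈ commonArms θ ↔ ∀ i, a ∈ supp (θ i) := by simp [commonArms]

lemma commonArms_subset (θ : Fin N → Dist K) (i : Fin N) : commonArms θ ⊆ supp (θ i) :=
  fun _ h => mem_commonArms.1 h i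

namespace RadiallySymmetricUniform

variable {θ : Fin N → Dist K} {M V : ℕ}

lemma apply_eq_zero_of_mem (hθ : RadiallySymmetricUniform θ M V) {i j : Fin N} {a : Fin K} (ha : a ∈ privateArms θ i) (hij : j ≠ i) :
    (θ j).1 a = 0 := by
  by_contra h
  rw [privateArms, Finset.mem_sdiff] at ha
  exact ha.2 (hθ.inter_supp j i hij ▸ Finset.mem_inter.2 ⟨mem_supp.2 h, ha.1⟩)

lemma eq_of_mem (hθ : RadiallySymmetricUniform θ M V) {i j : Fin N} {a : Fin K} (hi : a ∈ privateArms θ i)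
    (hj : a ∈ privateArms θ j) : j = i := by
  by_contra h
  exact mem_supp.1 (Finset.mem_sdiff.1 hj).1 (hθ.apply_eq_zero_of_mem hi h)

lemma card_privateArms (hθ : RadiallySymmetricUniform θ M V) (i : Fin N) : ((privateArms θ i).card : ℝ) = M - V := by
  rw [privateArms, Finset.cast_card_sdiff (commonArms_subset θ i), hθ.card_supp, hθ.card_common]

/-- The source of the factor α: it gives the similarity index, the scale of the losses and the rate
at which coins are revealed. -/
lemma sum_indicator (hθ : RadiallySymmetricUniform θ M V) (i j : Fin N) :
    ∑ a, (θ j).1 a * (if a ∈ privateArms θ i then 1 else 0) =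
      if j = i then ((M : ℝ) - V) / M else 0 := by
  simp only [mul_ite, mul_one, mul_zero]
  rw [← Finset.sum_filter, Finset.filter_mem_eq_inter, Finset.univ_inter]
  split_ifs with h
  · subst h
    rw [Finset.sum_congr rfl fun a (ha : a ∈ privateArms θ j) =>
      hθ.uniform j a (Finset.mem_sdiff.1 ha).1,
      Finset.sum_const, nsmul_eq_mul, hθ.card_privateArms]
    ring
  · exact Finset.sum_eq_zero fun a ha => hθ.apply_eq_zero_of_mem ha h

lemma one_lt (hθ : RadiallySymmetricUniform θ M V) (hN : 0 < N) (hVM : V < M) : 1 < N := by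
  by_contra h
  have h1 : N = 1 := by omega
  subst h1
  have : commonArms θ = supp (θ 0) := by
    ext a
    rw [mem_commonArms]
    exact ⟨fun h => h 0, fun h i => Subsingleton.elim 0 i ▸ h⟩
  have h2 := hθ.card_common
  rw [this, hθ.card_supp] at h2
  omega

/-- A private arm has mass under exactly one policy, so with two policies its minimum is 0; any
other arm has the same mass, 1/M or 0, under all of them. -/
lemma iSup_sub_iInf (hθ : RadiallySymmetricUniform θ M V) (hN : 1 < N) (a : Fin K) :
    (⨆ i, (θ i).1 a) - ⨅ i, (θ i).1 a =
      ∑ i, (θ i).1 a * (if a ∈ privateArms θ i then 1 else 0) := by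
  have : Nontrivial (Fin N) := Fin.nontrivial_iff_two_le.2 hN
  have hb : BddAbove (Set.range fun i => (θ i).1 a) := (Set.finite_range _).bddAbove
  have hb' : BddBelow (Set.range fun i => (θ i).1 a) := (Set.finite_range _).bddBelow
  by_cases hp : ∃ i, a ∈ privateArms θ i
  · obtain ⟨i, hi⟩ := hp
    obtain ⟨j, hj⟩ := exists_ne i
    have h1 : (⨆ k, (θ k).1 a) = (θ i).1 a := by
      refine le_antisymm (ciSup_le fun k => ?_) (le_ciSup hb i)
      rcases eq_or_ne k i with rfl | hk
      · exact le_rfl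
      · rw [hθ.apply_eq_zero_of_mem hi hk]
        exact (θ i).nonneg a
    have h2 : (⨅ k, (θ k).1 a) = 0 := by
      refine le_antisymm ?_ (le_ciInf fun k => (θ k).nonneg a)
      rw [← hθ.apply_eq_zero_of_mem hi hj]
      exact ciInf_le hb' j
    rw [h1, h2, Finset.sum_eq_single i]
    · simp [hi]
    · intro k _ hk
      rw [hθ.apply_eq_zero_of_mem hi hk, zero_mul]
    · simp
  · have hconst : ∃ c, ∀ i, (θ i).1 a = c := by
      by_cases hc : a ∈ commonArms θ
      · exact ⟨1 / M, fun i => hθ.uniform i a (commonArms_subset θ i hc)⟩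
      · refine ⟨0, fun i => ?_⟩
        by_contra h
        exact hp ⟨i, Finset.mem_sdiff.2 ⟨mem_supp.2 h, hc⟩⟩
    obtain ⟨c, hc⟩ := hconst
    push Not at hp
    simp [hc, hp]

lemma simStar_eq (hθ : RadiallySymmetricUniform θ M V) (hN : 1 < N) : simStar θ = N * (((M : ℝ) - V) / M) := by
  rw [simStar, Finset.sum_congr rfl fun a _ => hθ.iSup_sub_iInf hN a, Finset.sum_comm]
  simp_rw [hθ.sum_indicator]
  simp

end RadiallySymmetricUniform

end PrivateArms

/-! ### Coin losses and the regret they force. -/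

section BernoulliLosses

variable {N K T : ℕ}

/-- The losses given by coins `b`: at round `t`, the private arms of the policy `i` share the loss
`b (t, i)`, and all other arms have loss zero. -/
noncomputable def coinLoss (θ : Fin N → Dist K) (b : Fin T × Fin N → Bool) : LossSeq K := by
  classical
  exact fun t a => if ∃ h : t < T, ∃ i, a ∈ privateArms θ i ∧ b (⟨t, h⟩, i) = true then 1 else 0

/-- The weight of the coins `b` when the coins of the policy `i` are biased by `ε`. -/
noncomputable def coinTilt (ε : ℝ) (i : Fin N) (b : Fin T × Fin N → Bool) : ℝ :=
  ∏ t : Fin T, coinDensity ε (b (t, i))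

/-- The expected number of rounds in which the policy `i` is selected. -/
noncomputable def expectedPulls (θ : Fin N → Dist K) (alg : Algorithm N K) (ℓ : LossSeq K) (T : ℕ)
    (i : Fin N) : ℝ :=
  ∑ t : Fin T, ∑ ω, trajProb θ alg ℓ t ω * (alg t (observed ℓ ω)).1 i

lemma sum_expectedPulls (θ : Fin N → Dist K) (alg : Algorithm N K) (ℓ : LossSeq K) (T : ℕ) :
    ∑ i, expectedPulls θ alg ℓ T i = T := by
  simp_rw [expectedPulls]
  rw [Finset.sum_comm]
  simp_rw [Finset.sum_comm (s := (Finset.univ : Finset (Fin N))), ← Finset.mul_sum,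
    Dist.sum_eq_one, mul_one, sum_trajProb]
  simp

lemma expectedPulls_eq (θ : Fin N → Dist K) (alg : Algorithm N K) (ℓ : LossSeq K) (T : ℕ)
    (i : Fin N) : expectedPulls θ alg ℓ T i =
      ∑ ω, trajProb θ alg ℓ T ω * ∑ t : Fin T, if (ω t).1 = i then 1 else 0 := by
  rw [sum_trajProb_additive θ alg ℓ T fun _ j _ => if j = i then 1 else 0, expectedPulls]
  simp [Dist.sum_eq_one]

lemma coinLoss_update (θ : Fin N → Dist K) (b : Fin T × Fin N → Bool) (t : Fin T) (j : Fin N)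
    (y : Bool) (s : ℕ) (a : Fin K) (h : s ≠ t ∨ a ∉ privateArms θ j) :
    coinLoss θ (Function.update b (t, j) y) s a = coinLoss θ b s a := by
  classical
  simp only [coinLoss]
  refine if_congr ?_ rfl rfl
  refine exists_congr fun hs => exists_congr fun i => and_congr_right fun hi => ?_
  rw [Function.update_of_ne]
  rintro hij
  rw [Prod.mk.injEq] at hij
  rcases h with h | h
  · exact h (by rw [← hij.1])
  · exact h (hij.2 ▸ hi)

lemma coinLoss_of_mem {θ : Fin N → Dist K} {M V : ℕ} (hθ : RadiallySymmetricUniform θ M V)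
    (b : Fin T × Fin N → Bool) (t : Fin T) {i : Fin N} {a : Fin K} (ha : a ∈ privateArms θ i) :
    (coinLoss θ b t a : ℝ) = if b (t, i) then 1 else 0 := by
  have : (∃ h : (t : ℕ) < T, ∃ j, a ∈ privateArms θ j ∧ b (⟨t, h⟩, j) = true) ↔ b (t, i) := by
    constructor
    · rintro ⟨_, j, hj, hb⟩
      rwa [hθ.eq_of_mem ha hj] at hb
    · exact fun hb => ⟨t.2, i, ha, hb⟩
  simp only [coinLoss, this]
  split_ifs <;> simp

lemma coinLoss_of_mem_commonArms {θ : Fin N → Dist K} (b : Fin T × Fin N → Bool) (t : ℕ)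
    {a : Fin K} (ha : a ∈ commonArms θ) : coinLoss θ b t a = 0 := by
  simp only [coinLoss]
  rw [if_neg]
  rintro ⟨_, j, hj, _⟩
  exact (Finset.mem_sdiff.1 hj).2 ha

lemma policyLoss_coinLoss {θ : Fin N → Dist K} {M V : ℕ} (hθ : RadiallySymmetricUniform θ M V)
    (b : Fin T × Fin N → Bool) (t : Fin T) (i : Fin N) :
    policyLoss (θ i) (coinLoss θ b) t = ((M : ℝ) - V) / M * (if b (t, i) then 1 else 0) := by
  have h := hθ.sum_indicator i i
  rw [if_pos rfl] at h
  rw [← h, policyLoss, Finset.sum_mul]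
  refine Finset.sum_congr rfl fun a _ => ?_
  by_cases ha : a ∈ privateArms θ i
  · rw [coinLoss_of_mem hθ b t ha, if_pos ha, mul_one]
  · rw [if_neg ha, mul_zero, zero_mul]
    by_cases hs : a ∈ supp (θ i)
    · rw [coinLoss_of_mem_commonArms b t (by
        by_contra hc
        exact ha (Finset.mem_sdiff.2 ⟨hs, hc⟩))]
      simp
    · rw [mem_supp, not_not] at hs
      rw [hs, zero_mul]

lemma coinDensity_pos {ε : ℝ} (h0 : 0 ≤ ε) (h1 : ε ≤ 1 / 4) (x : Bool) : 0 < coinDensity ε x := by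
  cases x <;> simp [coinDensity] <;> linarith

lemma coinTilt_nonneg {ε : ℝ} (h0 : 0 ≤ ε) (h1 : ε ≤ 1 / 4) (i : Fin N)
    (b : Fin T × Fin N → Bool) : 0 ≤ coinTilt ε i b :=
  Finset.prod_nonneg fun _ _ => (coinDensity_pos h0 h1 _).le

lemma injective_coin (i : Fin N) : Function.Injective fun t : Fin T => (t, i) :=
  fun _ _ h => (Prod.mk.inj h).1

lemma sum_coinTilt (ε : ℝ) (i : Fin N) :
    ∑ b : Fin T × Fin N → Bool, coinTilt ε i b = Fintype.card (Fin T × Fin N → Bool) := by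
  have := sum_prod_coinDensity ε (fun t : Fin T => (t, i)) (injective_coin i) Finset.univ
    (fun _ => 1) (by simp)
  simpa [coinTilt] using this

/-- The expected loss of the policy `j` at round `t`, given the past, when the coins of `i` are
biased. -/
lemma sum_coinTilt_mul_coin (ε : ℝ) (i j : Fin N) (t : Fin T) (g : (Fin T × Fin N → Bool) → ℝ)
    (hg : ∀ b, g (Function.update b (t, j) (!b (t, j))) = g b) :
    ∑ b, coinTilt ε i b * (g b * if b (t, j) then 1 else 0) =
      ∑ b, coinTilt ε i b * (g b * (1 / 2 - if j = i then ε else 0)) := by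
  by_cases hij : j = i
  · subst hij
    let G : (Fin T × Fin N → Bool) → ℝ :=
      fun b => g b * ∏ s ∈ Finset.univ.erase t, coinDensity ε (b (s, j))
    have hG : ∀ b, G (Function.update b (t, j) (!b (t, j))) = G b := by
      intro b
      simp only [G, hg]
      congr 1
      refine Finset.prod_congr rfl fun s hs => ?_
      rw [Function.update_of_ne]
      exact fun h => Finset.ne_of_mem_erase hs (Prod.mk.inj h).1
    have h1 := sum_mul_coin (t, j) G (fun y => coinDensity ε y * if y then 1 else 0) hG
    have h2 := sum_mul_coin (t, j) G (coinDensity ε) hG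
    have ht : ∀ b : Fin T × Fin N → Bool, coinTilt ε j b =
        coinDensity ε (b (t, j)) * ∏ s ∈ Finset.univ.erase t, coinDensity ε (b (s, j)) :=
      fun b => (Finset.mul_prod_erase _ _ (Finset.mem_univ t)).symm
    simp_rw [ht]
    calc _ = ∑ b, (g b * ∏ s ∈ Finset.univ.erase t, coinDensity ε (b (s, j))) *
            (coinDensity ε (b (t, j)) * if b (t, j) then 1 else 0) :=
          Finset.sum_congr rfl fun b _ => by ring
      _ = (1 / 2 - ε) * ∑ b, (g b * ∏ s ∈ Finset.univ.erase t, coinDensity ε (b (s, j))) *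
            coinDensity ε (b (t, j)) := by
          change ∑ b, G b * _ = (1 / 2 - ε) * ∑ b, G b * _
          rw [h1, h2]
          simp only [coinDensity, if_true, Bool.false_eq_true, if_false]
          ring
      _ = _ := by
          rw [Finset.mul_sum]
          refine Finset.sum_congr rfl fun b _ => ?_
          simp only [if_true]
          ring
  · have h1 := sum_mul_coin (t, j) (fun b => coinTilt ε i b * g b)
      (fun y => if y then 1 else 0) (by
        intro b
        simp only [hg]
        congr 1
        refine Finset.prod_congr rfl fun s _ => ?_
        rw [Function.update_of_ne]
        exact fun h => hij (Prod.mk.inj h).2.symm)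
    simp_rw [if_neg hij, ← mul_assoc]
    rw [h1, ← Finset.sum_mul]
    simp
    ring

/-- The coins of round `t` are independent of everything before it, which is what permits averaging
them out. -/
lemma trajProb_coinLoss_update (θ : Fin N → Dist K) (alg : Algorithm N K)
    (b : Fin T × Fin N → Bool) (t : Fin T) (j : Fin N) (y : Bool) (ω : Fin t → Fin N × Fin K) :
    trajProb θ alg (coinLoss θ (Function.update b (t, j) y)) t ω =
      trajProb θ alg (coinLoss θ b) t ω :=
  trajProb_congr _ _ _ _ _ _ fun s => coinLoss_update _ _ _ _ _ _ _ (Or.inl s.2.ne)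

lemma observed_coinLoss_update (θ : Fin N → Dist K)
    (b : Fin T × Fin N → Bool) (t : Fin T) (j : Fin N) (y : Bool) (ω : Fin t → Fin N × Fin K) :
    observed (coinLoss θ (Function.update b (t, j) y)) ω = observed (coinLoss θ b) ω :=
  observed_congr _ _ _ _ fun s => coinLoss_update _ _ _ _ _ _ _ (Or.inl s.2.ne)

/-- When the coins of the policy `i` are biased, every round in which another policy is selected
costs `ε (M - V) / M`. -/
lemma sum_coinTilt_mul_regret_ge {θ : Fin N → Dist K} {M V : ℕ}
    (hθ : RadiallySymmetricUniform θ M V) (alg : Algorithm N K) {ε : ℝ} (h0 : 0 ≤ ε)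
    (h1 : ε ≤ 1 / 4) (i : Fin N) :
    ((M : ℝ) - V) / M * ε * (T * Fintype.card (Fin T × Fin N → Bool)
        - ∑ b : Fin T × Fin N → Bool, coinTilt ε i b * expectedPulls θ alg (coinLoss θ b) T i) ≤
      ∑ b : Fin T × Fin N → Bool, coinTilt ε i b * regret θ alg (coinLoss θ b) T := by
  set α := ((M : ℝ) - V) / M
  -- The best policy in hindsight does at least as well as the hidden policy `i`.
  have hle : ∀ b : Fin T × Fin N → Bool,
      (∑ t : Fin T, ∑ ω, trajProb θ alg (coinLoss θ b) t ω *
        ∑ j, (alg t (observed (coinLoss θ b) ω)).1 j * policyLoss (θ j) (coinLoss θ b) t)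
        - ∑ t : Fin T, policyLoss (θ i) (coinLoss θ b) t ≤ regret θ alg (coinLoss θ b) T := by
    intro b
    have : Nonempty (Fin N) := ⟨i⟩
    rw [regret_eq]
    exact sub_le_sub_left (ciInf_le
      (f := fun i => ∑ t : Fin T, policyLoss (θ i) (coinLoss θ b) t)
      (Set.finite_range _).bddBelow i) _
  refine le_trans (le_of_eq ?_) (Finset.sum_le_sum fun b _ =>
    mul_le_mul_of_nonneg_left (hle b) (coinTilt_nonneg h0 h1 i b))
  simp_rw [mul_sub]
  rw [Finset.sum_sub_distrib]
  have hB : ∑ b : Fin T × Fin N → Bool,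
      coinTilt ε i b * ∑ t : Fin T, policyLoss (θ i) (coinLoss θ b) t =
        α * (1 / 2 - ε) * (T * Fintype.card (Fin T × Fin N → Bool)) := by
    simp_rw [policyLoss_coinLoss hθ, Finset.mul_sum]
    rw [Finset.sum_comm]
    have h := fun t : Fin T => sum_coinTilt_mul_coin ε i i t (fun _ => α) (fun _ => rfl)
    rw [Finset.sum_congr rfl fun t _ => h t]
    simp_rw [← Finset.sum_mul, sum_coinTilt]
    simp
    ring
  -- Given the past, each round-`t` coin is replaced by its mean, 1/2 - ε for `i` and 1/2 for the
  -- others.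
  have hA : ∑ b : Fin T × Fin N → Bool, coinTilt ε i b *
      (∑ t : Fin T, ∑ ω, trajProb θ alg (coinLoss θ b) t ω *
        ∑ j, (alg t (observed (coinLoss θ b) ω)).1 j * policyLoss (θ j) (coinLoss θ b) t) =
      ∑ b : Fin T × Fin N → Bool, coinTilt ε i b *
        (α / 2 * T - α * ε * expectedPulls θ alg (coinLoss θ b) T i) := by
    calc _ = ∑ t : Fin T, ∑ ω : Fin t → Fin N × Fin K, ∑ j, ∑ b : Fin T × Fin N → Bool,
          coinTilt ε i b * ((trajProb θ alg (coinLoss θ b) t ω *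
            (alg t (observed (coinLoss θ b) ω)).1 j * α) * if b (t, j) then 1 else 0) := by
          simp_rw [policyLoss_coinLoss hθ, Finset.mul_sum]
          rw [Finset.sum_comm]
          refine Finset.sum_congr rfl fun t _ => ?_
          rw [Finset.sum_comm]
          refine Finset.sum_congr rfl fun ω _ => ?_
          rw [Finset.sum_comm]
          refine Finset.sum_congr rfl fun j _ => Finset.sum_congr rfl fun b _ => ?_
          ring
      _ = ∑ t : Fin T, ∑ ω : Fin t → Fin N × Fin K, ∑ j, ∑ b : Fin T × Fin N → Bool,
          coinTilt ε i b * ((trajProb θ alg (coinLoss θ b) t ω *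
            (alg t (observed (coinLoss θ b) ω)).1 j * α) * (1 / 2 - if j = i then ε else 0)) := by
          refine Finset.sum_congr rfl fun t _ => Finset.sum_congr rfl fun ω _ =>
            Finset.sum_congr rfl fun j _ => sum_coinTilt_mul_coin ε i j t _ fun b => ?_
          rw [trajProb_coinLoss_update, observed_coinLoss_update]
      _ = ∑ b : Fin T × Fin N → Bool, coinTilt ε i b *
            ∑ t : Fin T, ∑ ω : Fin t → Fin N × Fin K, trajProb θ alg (coinLoss θ b) t ω *
            ∑ j, (alg t (observed (coinLoss θ b) ω)).1 j *
              (α * (1 / 2 - if j = i then ε else 0)) := by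
          simp_rw [Finset.mul_sum]
          symm
          rw [Finset.sum_comm]
          refine Finset.sum_congr rfl fun t _ => ?_
          rw [Finset.sum_comm]
          refine Finset.sum_congr rfl fun ω _ => ?_
          rw [Finset.sum_comm]
          refine Finset.sum_congr rfl fun j _ => Finset.sum_congr rfl fun b _ => ?_
          ring
      _ = _ := by
          refine Finset.sum_congr rfl fun b _ => ?_
          congr 1
          have hj : ∀ (t : Fin T) (ω : Fin t → Fin N × Fin K),
              ∑ j, (alg t (observed (coinLoss θ b) ω)).1 j *
                (α * (1 / 2 - if j = i then ε else 0)) =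
              α / 2 - α * ε * (alg t (observed (coinLoss θ b) ω)).1 i := by
            intro t ω
            simp_rw [mul_sub, Finset.sum_sub_distrib, ← Finset.sum_mul, Dist.sum_eq_one]
            simp
            ring
          simp_rw [hj, mul_sub, Finset.sum_sub_distrib, ← Finset.sum_mul, sum_trajProb,
            expectedPulls, Finset.mul_sum]
          congr 1
          · simp; ring
          · exact Finset.sum_congr rfl fun t _ => Finset.sum_congr rfl fun ω _ => by ring
  rw [hA, hB]
  simp_rw [mul_sub, Finset.sum_sub_distrib, ← Finset.sum_mul, sum_coinTilt, Finset.mul_sum]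
  have : ∑ b : Fin T × Fin N → Bool,
      coinTilt ε i b * (α * ε * expectedPulls θ alg (coinLoss θ b) T i) =
      ∑ b : Fin T × Fin N → Bool,
        α * ε * (coinTilt ε i b * expectedPulls θ alg (coinLoss θ b) T i) :=
    Finset.sum_congr rfl fun b _ => by ring
  rw [this]
  ring

end BernoulliLosses

end FixedExperts

namespace FixedExperts

/-! ### Change of measure and the choice of the bias. -/

section LowerBound

variable {N K T : ℕ}

/-- The likelihood ratio of the observations when the coins of the policy `i` are biased. -/
noncomputable def obsRatio (θ : Fin N → Dist K) (ε : ℝ) (i : Fin N) (b : Fin T × Fin N → Bool)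
    (ω : Fin T → Fin N × Fin K) : ℝ :=
  ∏ t : Fin T with (ω t).2 ∈ privateArms θ i, coinDensity ε (b (t, i))

/-- Coins of `i` in rounds whose drawn arm is not private to `i` do not affect the trajectory, so
their densities average to 1. Thus `obsRatio` gives the same trajectory law as `coinTilt` while
charging entropy only for revealed coins. -/
lemma sum_trajProb_mul_obsRatio (θ : Fin N → Dist K) (alg : Algorithm N K) (ε : ℝ) (i : Fin N)
    (ω : Fin T → Fin N × Fin K) :
    ∑ b : Fin T × Fin N → Bool, trajProb θ alg (coinLoss θ b) T ω * obsRatio θ ε i b ω =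
      ∑ b : Fin T × Fin N → Bool, coinTilt ε i b * trajProb θ alg (coinLoss θ b) T ω := by
  rw [← sum_prod_coinDensity ε (fun t : Fin T => (t, i)) (injective_coin i)
    {t : Fin T | (ω t).2 ∉ privateArms θ i}]
  · refine Finset.sum_congr rfl fun b _ => ?_
    rw [obsRatio, coinTilt, mul_assoc, Finset.prod_filter_mul_prod_filter_not, mul_comm]
  · intro t ht b
    have ht' : (ω t).2 ∉ privateArms θ i := by simpa using ht
    congr 1
    · refine trajProb_congr _ _ _ _ _ _ fun s => coinLoss_update _ _ _ _ _ _ _ ?_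
      rcases eq_or_ne s t with rfl | hs
      · exact Or.inr ht'
      · exact Or.inl fun h => hs (Fin.ext h)
    · refine Finset.prod_congr rfl fun s hs => ?_
      rw [Function.update_of_ne]
      intro h
      rw [(Prod.mk.inj h).1] at hs
      exact ht' (by simpa using hs)

/-- The relative entropy of a fair coin with respect to a coin with bias `ε`. -/
noncomputable def coinEntropy (ε : ℝ) : ℝ := -(Real.log (1 - 2 * ε) + Real.log (1 + 2 * ε)) / 2

/-- The relative entropy of the observations is proportional to the expected number of times the
policy `i` is selected. -/
lemma sum_neg_log_obsRatio {θ : Fin N → Dist K} {M V : ℕ}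
    (hθ : RadiallySymmetricUniform θ M V) (alg : Algorithm N K) {ε : ℝ} (h0 : 0 ≤ ε)
    (h1 : ε ≤ 1 / 4) (i : Fin N) :
    ∑ b : Fin T × Fin N → Bool, ∑ ω : Fin T → Fin N × Fin K,
        trajProb θ alg (coinLoss θ b) T ω * -Real.log (obsRatio θ ε i b ω) =
      ((M : ℝ) - V) / M * coinEntropy ε *
        ∑ b : Fin T × Fin N → Bool, expectedPulls θ alg (coinLoss θ b) T i := by
  set α := ((M : ℝ) - V) / M
  let x : (Fin T × Fin N → Bool) → ℕ → ℝ :=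
    fun b t => if h : t < T then -Real.log (coinDensity ε (b (⟨t, h⟩, i))) else 0
  have hx : ∀ b (t : Fin T), x b t = -Real.log (coinDensity ε (b (t, i))) := by
    intro b t
    simp [x]
  have hlog : ∀ (b : Fin T × Fin N → Bool) (ω : Fin T → Fin N × Fin K),
      -Real.log (obsRatio θ ε i b ω) =
        ∑ t : Fin T, (if (ω t).2 ∈ privateArms θ i then 1 else 0) * x b t := by
    intro b ω
    rw [obsRatio, Real.log_prod fun t _ => (coinDensity_pos h0 h1 _).ne', Finset.sum_filter,
      ← Finset.sum_neg_distrib]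
    refine Finset.sum_congr rfl fun t _ => ?_
    rw [hx]
    split_ifs <;> simp
  have hadd : ∀ b : Fin T × Fin N → Bool, ∑ ω : Fin T → Fin N × Fin K,
      trajProb θ alg (coinLoss θ b) T ω * -Real.log (obsRatio θ ε i b ω) =
      ∑ t : Fin T, ∑ ω, trajProb θ alg (coinLoss θ b) t ω *
        (alg t (observed (coinLoss θ b) ω)).1 i * α * -Real.log (coinDensity ε (b (t, i))) := by
    intro b
    simp_rw [hlog]
    rw [sum_trajProb_additive θ alg (coinLoss θ b) T
      fun t _ a => (if a ∈ privateArms θ i then 1 else 0) * x b t]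
    refine Finset.sum_congr rfl fun t _ => Finset.sum_congr rfl fun ω _ => ?_
    simp_rw [← mul_assoc, ← Finset.sum_mul, hθ.sum_indicator, hx]
    simp [α, mul_assoc]
  simp_rw [hadd, expectedPulls]
  rw [Finset.sum_comm, Finset.sum_comm (t := (Finset.univ : Finset (Fin T))), Finset.mul_sum]
  refine Finset.sum_congr rfl fun t _ => ?_
  rw [Finset.sum_comm, Finset.sum_comm (t := (Finset.univ : Finset (Fin t → Fin N × Fin K))),
    Finset.mul_sum]
  refine Finset.sum_congr rfl fun ω _ => ?_
  -- Under a fair coin the mean of -log density is `coinEntropy ε`.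
  rw [sum_mul_coin (t, i) (fun b => trajProb θ alg (coinLoss θ b) t ω *
    (alg t (observed (coinLoss θ b) ω)).1 i * α) (fun y => -Real.log (coinDensity ε y))]
  · rw [← Finset.sum_mul, coinEntropy]
    simp only [coinDensity, if_true, Bool.false_eq_true, if_false]
    ring
  · intro b
    rw [trajProb_coinLoss_update, observed_coinLoss_update]

lemma obsRatio_pos (θ : Fin N → Dist K) {ε : ℝ} (h0 : 0 ≤ ε) (h1 : ε ≤ 1 / 4) (i : Fin N)
    (b : Fin T × Fin N → Bool) (ω : Fin T → Fin N × Fin K) : 0 < obsRatio θ ε i b ω :=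
  Finset.prod_pos fun _ _ => coinDensity_pos h0 h1 _

/-- Biasing the coins of the policy `i` changes the expected number of its selections only a
little. -/
lemma sum_coinTilt_mul_expectedPulls_le {θ : Fin N → Dist K} {M V : ℕ}
    (hθ : RadiallySymmetricUniform θ M V) (alg : Algorithm N K) {ε : ℝ} (h0 : 0 ≤ ε)
    (h1 : ε ≤ 1 / 4) (hT : 0 < T) (i : Fin N) :
    ∑ b : Fin T × Fin N → Bool, coinTilt ε i b * expectedPulls θ alg (coinLoss θ b) T i ≤
      (1 + T * (((M : ℝ) - V) / M * coinEntropy ε)) *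
          ∑ b : Fin T × Fin N → Bool, expectedPulls θ alg (coinLoss θ b) T i
        + T / 8 * Fintype.card (Fin T × Fin N → Bool) := by
  have hT' : (0 : ℝ) < T := by exact_mod_cast hT
  set C : ℝ := ((Fintype.card (Fin T × Fin N → Bool) : ℕ) : ℝ) with hC
  have hC0 : 0 < C := by
    rw [hC]
    exact_mod_cast Fintype.card_pos
  -- The joint law of uniform coins and the trajectory; `L` is its likelihood ratio, and the
  -- selection count over T is the [0, 1]-valued test function.
  let p : (Fin T × Fin N → Bool) × (Fin T → Fin N × Fin K) → ℝ :=
    fun x => trajProb θ alg (coinLoss θ x.1) T x.2 / C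
  let L : (Fin T × Fin N → Bool) × (Fin T → Fin N × Fin K) → ℝ := fun x => obsRatio θ ε i x.1 x.2
  let c : (Fin T → Fin N × Fin K) → ℝ := fun ω => ∑ t : Fin T, if (ω t).1 = i then 1 else 0
  have hc : ∀ ω, c ω / T ∈ Set.Icc (0 : ℝ) 1 := by
    intro ω
    have h2 : 0 ≤ c ω := Finset.sum_nonneg fun t _ => by split_ifs <;> norm_num
    have h3 : c ω ≤ T := by
      calc c ω ≤ ∑ _t : Fin T, (1 : ℝ) :=
            Finset.sum_le_sum fun t _ => by split_ifs <;> norm_num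
        _ = T := by simp
    exact ⟨div_nonneg h2 hT'.le, (div_le_one hT').2 h3⟩
  have hLF : ∀ F : (Fin T → Fin N × Fin K) → ℝ, ∑ x, p x * L x * F x.2 =
      (∑ b : Fin T × Fin N → Bool, coinTilt ε i b *
        ∑ ω, trajProb θ alg (coinLoss θ b) T ω * F ω) / C := by
    intro F
    calc _ = (∑ ω, (∑ b : Fin T × Fin N → Bool,
            trajProb θ alg (coinLoss θ b) T ω * obsRatio θ ε i b ω) * F ω) / C := by
          rw [Fintype.sum_prod_type_right, Finset.sum_div]
          refine Finset.sum_congr rfl fun ω _ => ?_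
          rw [Finset.sum_mul, Finset.sum_div]
          exact Finset.sum_congr rfl fun b _ => by simp only [p, L]; ring
      _ = _ := by
          simp_rw [sum_trajProb_mul_obsRatio, Finset.sum_mul, Finset.mul_sum]
          rw [Finset.sum_comm]
          simp_rw [mul_assoc]
  have hpF : ∀ F : (Fin T × Fin N → Bool) → (Fin T → Fin N × Fin K) → ℝ,
      ∑ x, p x * F x.1 x.2 =
        (∑ b, ∑ ω, trajProb θ alg (coinLoss θ b) T ω * F b ω) / C := by
    intro F
    rw [Fintype.sum_prod_type, Finset.sum_div]
    refine Finset.sum_congr rfl fun b _ => ?_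
    rw [Finset.sum_div]
    exact Finset.sum_congr rfl fun ω _ => by simp only [p]; ring
  have hp1 : ∑ x, p x = 1 := by
    have := hpF fun _ _ => 1
    simp_rw [mul_one, sum_trajProb] at this
    rw [this]
    simp only [Finset.sum_const, Finset.card_univ, nsmul_eq_mul, mul_one]
    exact div_self hC0.ne'
  have hL1 : ∑ x, p x * L x = 1 := by
    have := hLF fun _ => 1
    simp_rw [mul_one, sum_trajProb, mul_one, sum_coinTilt] at this
    rw [this]
    exact div_self hC0.ne'
  have h := sum_tilted_le p L (fun x => c x.2 / T)
    (fun x => div_nonneg (trajProb_nonneg _ _ _ _ _) hC0.le) hp1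
    (fun x => obsRatio_pos θ h0 h1 i x.1 x.2) hL1 (fun x => hc x.2)
  rw [hLF (fun ω => c ω / T), hpF (fun _ ω => c ω / T),
    hpF (fun b ω => -Real.log (obsRatio θ ε i b ω)), sum_neg_log_obsRatio hθ alg h0 h1] at h
  have hcount : ∀ b : Fin T × Fin N → Bool,
      ∑ ω, trajProb θ alg (coinLoss θ b) T ω * (c ω / T) =
        expectedPulls θ alg (coinLoss θ b) T i / T := by
    intro b
    rw [expectedPulls_eq, Finset.sum_div]
    exact Finset.sum_congr rfl fun ω _ => by simp only [c]; ring
  simp_rw [hcount, ← mul_div_assoc, ← Finset.sum_div] at h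
  set E := ∑ b : Fin T × Fin N → Bool, expectedPulls θ alg (coinLoss θ b) T i
  set E' := ∑ b : Fin T × Fin N → Bool, coinTilt ε i b * expectedPulls θ alg (coinLoss θ b) T i
  have h2 := mul_le_mul_of_nonneg_left h (mul_pos hT' hC0).le
  have e1 : T * C * (E' / T / C) = E' := by field_simp
  have e2 : T * C * (E / T / C + 1 / 8 + ((M : ℝ) - V) / M * coinEntropy ε * E / C) =
      (1 + T * (((M : ℝ) - V) / M * coinEntropy ε)) * E + T / 8 * C := by
    field_simp
    ring
  rw [e1] at h2
  exact h2.trans e2.le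

/-- The entropy is -log(1 - 4ε²)/2, and 1 - 4ε² lies in [3/4, 1], where the concave log is above its
chord. -/
lemma coinEntropy_le {ε : ℝ} (h0 : 0 ≤ ε) (h1 : ε ≤ 1 / 4) :
    coinEntropy ε ≤ 8 * Real.log (4 / 3) * ε ^ 2 := by
  have hsq : 16 * ε ^ 2 ≤ 1 := by nlinarith
  have h2 : Real.log (1 - 2 * ε) + Real.log (1 + 2 * ε) = Real.log (1 - 4 * ε ^ 2) := by
    rw [← Real.log_mul (by linarith) (by linarith)]
    congr 1
    ring
  have h3 := strictConcaveOn_log_Ioi.concaveOn.2 (show (3 / 4 : ℝ) ∈ Set.Ioi 0 by norm_num)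
    (show (1 : ℝ) ∈ Set.Ioi 0 by norm_num) (show 0 ≤ 16 * ε ^ 2 by positivity)
    (show 0 ≤ 1 - 16 * ε ^ 2 by linarith) (by ring)
  simp only [smul_eq_mul, Real.log_one, mul_zero, add_zero, mul_one] at h3
  have h4 : 16 * ε ^ 2 * (3 / 4) + (1 - 16 * ε ^ 2) = 1 - 4 * ε ^ 2 := by ring
  have h5 : Real.log (3 / 4) = -Real.log (4 / 3) := by
    rw [← Real.log_inv]
    norm_num
  rw [h4, h5] at h3
  rw [coinEntropy, h2]
  linarith

/-- Here 81/256 = (9/16)², which makes 32 √(log(4/3)) ≤ 18, the constant of the theorem. -/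
lemma log_four_thirds_le : Real.log (4 / 3) ≤ 81 / 256 := by
  have h1 : Real.log (4 / 3) ≤ Real.log ((23 / 20 + 1 / 200) ^ 2) :=
    Real.log_le_log (by norm_num) (by norm_num)
  rw [Real.log_pow] at h1
  have h2 := Real.log_le_sub_one_of_pos (show (0 : ℝ) < 23 / 20 + 1 / 200 by norm_num)
  norm_num at h1 h2 ⊢
  linarith

/-- Every algorithm has large regret on some loss sequence. -/
theorem exists_regret_ge {θ : Fin N → Dist K} {M V : ℕ} (hθ : RadiallySymmetricUniform θ M V)
    (hN : 1 < N) (hVM : V < M)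
    (hT : (N : ℝ) * M / (4 * Real.log (4 / 3) * ((M : ℝ) - V)) ≤ T) (alg : Algorithm N K) :
    ∃ ℓ : LossSeq K, 1 / 18 * Real.sqrt (N * (((M : ℝ) - V) / M) * T) ≤ regret θ alg ℓ T := by
  have hN2 : (2 : ℝ) ≤ N := by exact_mod_cast hN
  have hMV : (0 : ℝ) < (M : ℝ) - V := sub_pos.2 (by exact_mod_cast hVM)
  have hM : (0 : ℝ) < M := by exact_mod_cast (Nat.zero_le V).trans_lt hVM
  set α := ((M : ℝ) - V) / M with hα
  have hα0 : 0 < α := div_pos hMV hM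
  set c := Real.log (4 / 3) with hc
  have hc0 : 0 < c := Real.log_pos (by norm_num)
  have hNT : (N : ℝ) ≤ 4 * c * α * T := by
    rw [div_le_iff₀ (by positivity)] at hT
    have : 4 * c * α * T = T * (4 * c * ((M : ℝ) - V)) / M := by rw [hα]; ring
    rw [this, le_div_iff₀ hM]
    exact hT
  have hT0 : (0 : ℝ) < T := by
    by_contra h
    have : 4 * c * α * T ≤ 0 := mul_nonpos_of_nonneg_of_nonpos (by positivity) (not_lt.1 h)
    linarith
  have hTn : 0 < T := by exact_mod_cast hT0
  -- Chosen so that T α · 8cε² = N/8; the hypothesis on T is exactly ε ≤ 1/4.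
  set ε := Real.sqrt (N / (64 * (c * α * T))) with hε
  have hε0 : 0 ≤ ε := Real.sqrt_nonneg _
  have hε2 : ε ^ 2 = N / (64 * (c * α * T)) := Real.sq_sqrt (by positivity)
  have hε1 : ε ≤ 1 / 4 := by
    refine Real.sqrt_le_iff.2 ⟨by norm_num, ?_⟩
    rw [div_le_iff₀ (by positivity)]
    linarith
  have hbound : 1 / 18 * Real.sqrt (N * α * T) ≤ α * ε * T / 4 := by
    refine abs_le_of_sq_le_sq' ?_ (by positivity) |>.2
    have e : (α * ε * T / 4) ^ 2 = N * α * T / (1024 * c) := by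
      rw [div_pow, mul_pow, mul_pow, hε2]
      field_simp
      norm_num
    rw [e, mul_pow, Real.sq_sqrt (by positivity), le_div_iff₀ (by positivity)]
    nlinarith [mul_le_mul_of_nonneg_left log_four_thirds_le
      (by positivity : (0 : ℝ) ≤ N * α * T)]
  have hent : T * (α * coinEntropy ε) ≤ N / 8 := by
    calc T * (α * coinEntropy ε) ≤ T * (α * (8 * c * ε ^ 2)) := by
          gcongr
          exact coinEntropy_le hε0 hε1
      _ = N / 8 := by
          rw [hε2]
          field_simp
          norm_num
  set C : ℝ := ((Fintype.card (Fin T × Fin N → Bool) : ℕ) : ℝ) with hC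
  have hC0 : 0 < C := by
    rw [hC]
    exact_mod_cast Fintype.card_pos
  have hpulls : ∑ i, ∑ b : Fin T × Fin N → Bool,
      coinTilt ε i b * expectedPulls θ alg (coinLoss θ b) T i ≤ 3 / 4 * (N * T * C) := by
    have hsum : ∑ i, ∑ b : Fin T × Fin N → Bool, expectedPulls θ alg (coinLoss θ b) T i =
        T * C := by
      rw [Finset.sum_comm]
      simp_rw [sum_expectedPulls]
      simp only [Finset.sum_const, Finset.card_univ, nsmul_eq_mul]
      exact mul_comm _ _
    refine (Finset.sum_le_sum fun i _ =>
      sum_coinTilt_mul_expectedPulls_le hθ alg hε0 hε1 hTn i).trans ?_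
    rw [Finset.sum_add_distrib, ← Finset.mul_sum, hsum]
    simp only [Finset.sum_const, Finset.card_univ, Fintype.card_fin, nsmul_eq_mul]
    change (1 + T * (α * coinEntropy ε)) * (T * C) + N * (T / 8 * C) ≤ _
    -- As N ≥ 2, 1 ≤ N/2, so the factor is at most N/2 + N/8; the Hoeffding term adds another N/8,
    -- for 3N/4 in all.
    have : (1 + T * (α * coinEntropy ε)) * (T * C) ≤ (5 / 8 * N) * (T * C) := by
      gcongr
      linarith
    linarith
  have htot : ∑ i, ∑ b : Fin T × Fin N → Bool,
        coinTilt ε i b * (1 / 18 * Real.sqrt (N * α * T)) ≤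
      ∑ i, ∑ b : Fin T × Fin N → Bool, coinTilt ε i b * regret θ alg (coinLoss θ b) T := by
    refine le_trans ?_ (Finset.sum_le_sum fun i _ =>
      sum_coinTilt_mul_regret_ge hθ alg hε0 hε1 i)
    simp_rw [← Finset.sum_mul, sum_coinTilt, ← Finset.mul_sum]
    rw [Finset.sum_sub_distrib]
    simp only [Finset.sum_const, Finset.card_univ, Fintype.card_fin, nsmul_eq_mul]
    change (N : ℝ) * C * (1 / 18 * Real.sqrt (N * α * T)) ≤ α * ε * (N * (T * C) - _)
    calc (N : ℝ) * C * (1 / 18 * Real.sqrt (N * α * T)) ≤ N * C * (α * ε * T / 4) := by gcongr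
      _ = α * ε * (N * (T * C) - 3 / 4 * (N * T * C)) := by ring
      _ ≤ _ := by gcongr
  have hne : (Finset.univ : Finset (Fin N)).Nonempty := ⟨⟨0, by omega⟩, Finset.mem_univ _⟩
  -- Averaging over the hidden policy and then the coins selects one outcome; its weight is positive
  -- since ε ≤ 1/4, and cancels.
  obtain ⟨i, _, hi⟩ := Finset.exists_le_of_sum_le hne htot
  obtain ⟨b, _, hb⟩ := Finset.exists_le_of_sum_le
    (Finset.univ_nonempty (α := Fin T × Fin N → Bool)) hi
  have hpos : 0 < coinTilt ε i b := Finset.prod_pos fun _ _ => coinDensity_pos hε0 hε1 _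
  exact ⟨coinLoss θ b, le_of_mul_le_mul_left hb hpos⟩

end LowerBound

end FixedExperts

theorem theorem4 (N K M V T : ℕ) (hN : 0 < N) (θ : Fin N → FixedExperts.Dist K)
    (hθ : FixedExperts.RadiallySymmetricUniform θ M V) (hVM : V < M)
    (hT : (N : ℝ) * M / (4 * Real.log (4 / 3) * ((M : ℝ) - V)) ≤ T) :
    (∀ alg : FixedExperts.Algorithm N K, ∃ ℓ : FixedExperts.LossSeq K,
      1 / 18 * Real.sqrt (N * (((M : ℝ) - V) / M) * T) ≤ FixedExperts.regret θ alg ℓ T) ∧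
    FixedExperts.simStar θ = N * (((M : ℝ) - V) / M) ∧
    (∀ ℓ : FixedExperts.LossSeq K,
      FixedExperts.regret θ
          (FixedExperts.exp4 hN θ (Real.sqrt (2 * Real.log N / (T * FixedExperts.simStar θ)))) ℓ T
        ≤ Real.sqrt (2 * T * FixedExperts.simStar θ * Real.log N)) := by
  have hN1 := hθ.one_lt hN hVM
  have hN0 : (0 : ℝ) < N := by exact_mod_cast hN
  have hMV : (0 : ℝ) < (M : ℝ) - V := sub_pos.2 (by exact_mod_cast hVM)
  have hM : (0 : ℝ) < M := by exact_mod_cast (Nat.zero_le V).trans_lt hVM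
  have hlog : 0 < Real.log (4 / 3) := Real.log_pos (by norm_num)
  have hT0 : 0 < T := by
    have : (0 : ℝ) < T := lt_of_lt_of_le (by positivity) hT
    exact_mod_cast this
  refine ⟨FixedExperts.exists_regret_ge hθ hN1 hVM hT, hθ.simStar_eq hN1, fun ℓ => ?_⟩
  refine FixedExperts.exp4_regret_le_sqrt hN1 θ ?_ ℓ hT0
  rw [hθ.simStar_eq hN1]
  positivity
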